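/- Let $(M,T)$ be a connected closed triangulated surface: $T$ is a finite simplicial complex of dimension $2$ with vertex set $V$, edge set $E$ and set of directed edges $E_+$, in which every vertex lies on a triangle, every edge lies on exactly two triangles, and the link of every vertex is connected (equivalently, a cycle). A function $\ell:E\to\mathbb R$ is \emph{piecewise flat} if every simplex of $T$ can be embedded as a nondegenerate Euclidean simplex with edge lengths $\ell$. A \emph{metric} is a function $d:E_+\to\mathbb R$ such that $\ell_{ij}=d_{ij}+d_{ji}$ is piecewise flat and $d_{ij}^2+d_{jk}^2+d_{ki}^2=d_{ji}^2+d_{ik}^2+d_{kj}^2$ for every triangle $\{i,j,k\}$; then $(M,T,d)$ is called a \emph{piecewise flat, metrized surface}. Let $\gamma_{i,jk}$ be the angle at $i$ of the Euclidean triangle $\{i,j,k\}$ with side lengths $\ell$, and define the curvature $K_i=2\pi-\sum\gamma_{i,jk}$, the sum being over the triangles $\{i,j,k\}$ at $i$. Put $h_{ij,k}=(d_{ik}-d_{ij}\cos\gamma_{i,jk})/\sin\gamma_{i,jk}$ and $\ell^*_{ij}=h_{ij,k}+h_{ij,l}$, where $\{i,j,k\}$ and $\{i,j,l\}$ are the two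 triangles at $\{i,j\}$. If $\{i,j,k\}$ is embedded isometrically in the plane with vertices $v_i,v_j,v_k$, its \emph{center} $c_{ijk}$ is the point whose orthogonal projection to each side $v_av_b$ is the point of the line $v_av_b$ at signed distance $d_{ab}$ from $v_a$ and $d_{ba}$ from $v_b$. A \emph{conformal structure} on an open set $U\subset\mathbb R^V$ is a smooth map $f\mapsto d(f)$ from $U$ to the set of metrics such that, with $\ell(f)$ the lengths of $d(f)$, on $U$ one has $\partial \ell_{ij}/\partial f_i=d_{ij}$ for each $(i,j)\in E_+$ and $\partial d_{ij}/\partial f_k=0$ for each vertex $k\ne i,j$. A \emph{conformal variation} of $(M,T,d)$ is a smooth curve $f:(-\varepsilon,\varepsilon)\to\mathbb R^V$, $\varepsilon>0$, for which there is a conformal structure (an \emph{extension}) on an open set containing its image with $d(f(0))=d$. We call $(M,T,d)$ \emph{rigid with respect to conformal variations} if, for every conformal variation $f$ and every extension of it such that all curvatures $K_i$ of $d(f(t))$ are independent of $t\in(-\varepsilon,\varepsilon)$, the edge lengths are only scaled uniformly: for every $t\in(-\varepsilon,\varepsilon)$ there is $c(t)>0$ with $\ell_{ij}(f(t))=c(t)\,\ell_{ij}(f(0))$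 for all edges $\{i,j\}$. \textbf{Theorem.} Let $(M,T,d)$ be a piecewise flat, metrized surface with $(M,T)$ connected and closed, and with $K_i=0$ for all $i\in V$. Suppose that at least one of the following holds: \begin{enumerate} \item $\ell^*_{ij}>0$ for all edges $\{i,j\}$; \item $d$ belongs to a fixed inversive distance conformal structure with nonnegative inversive distances: there are $\eta:E\to[0,\infty)$ and $f\in\mathbb R^V$ with $d_{ij}=\dfrac{e^{f_i}(e^{f_i}+e^{f_j}\eta_{ij})}{\sqrt{e^{2f_i}+e^{2f_j}+2e^{f_i}e^{f_j}\eta_{ij}}}$ for all $(i,j)\in E_+$; \item $d_{ij}>0$ for all $(i,j)\in E_+$; \item $d$ belongs to a perpendicular bisector conformal structure: there are a piecewise flat $L:E\to\mathbb R$ and $f\in\mathbb R^V$ with $d_{ij}=\tfrac12 e^{\frac12(f_i+f_j)}L_{ij}$ for all $(i,j)\in E_+$; \item for each triangle embedded isometrically in the plane as $v_iv_jv_k$, the center $c_{ijk}$ lies strictly inside the circumcircle of $v_iv_jv_k$. \end{enumerate} Then $(M,T,d)$ is rigid with respect to conformal variations. -/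

import Mathlib

open scoped ContDiff

/-- A closed triangulated surface with vertex set `V`: a finite two-dimensional simplicial complex,
given by its set of triangles, in which every vertex lies on a triangle, every edge lies on exactly
two triangles, and the link of every vertex is connected (hence a single cycle).  The edges are the
pairs of distinct vertices that lie on a common triangle. -/
structure TriangulatedSurface (V : Type*) [Fintype V] [DecidableEq V] where
  triangles : Finset (Finset V)
  card_triangle : ∀ t ∈ triangles, t.card = 3
  exists_triangle : ∀ i : V, ∃ t ∈ triangles, i ∈ t
  card_edge : ∀ i j : V, i ≠ j → (∃ t ∈ triangles, i ∈ t ∧ j ∈ t) →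
    (triangles.filter (fun t => i ∈ t ∧ j ∈ t)).card = 2
  link_connected : ∀ i j k : V, i ≠ j → i ≠ k →
    (∃ t ∈ triangles, i ∈ t ∧ j ∈ t) → (∃ t ∈ triangles, i ∈ t ∧ k ∈ t) →
    (SimpleGraph.fromRel (fun a b : V => {i, a, b} ∈ triangles)).Reachable j k

noncomputable section

namespace TriangulatedSurface

variable {V : Type*} [Fintype V] [DecidableEq V]

/-- The one-skeleton: its adjacent ordered pairs `(i, j)` are the directed edges `E₊(T)`. -/
def skeleton (S : TriangulatedSurface V) : SimpleGraph V where
  Adj i j := i ≠ j ∧ ∃ t ∈ S.triangles, i ∈ t ∧ j ∈ t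
  symm := ⟨fun _ _ h => ⟨h.1.symm, h.2.imp fun _ ht => ⟨ht.1, ht.2.2, ht.2.1⟩⟩⟩
  loopless := ⟨fun _ h => h.1 rfl⟩

/-- `{i, j, k}` is a triangle; in particular `i`, `j`, `k` are distinct. -/
def IsTriangle (S : TriangulatedSurface V) (i j k : V) : Prop :=
  ({i, j, k} : Finset V) ∈ S.triangles

instance (S : TriangulatedSurface V) (i j k : V) : Decidable (S.IsTriangle i j k) :=
  inferInstanceAs (Decidable (({i, j, k} : Finset V) ∈ S.triangles))

end TriangulatedSurface

namespace PiecewiseFlat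

variable {V : Type*} [Fintype V] [DecidableEq V]

/-! Functions on undirected edges are written as functions on `Sym2 V`, functions on directed edges
as functions `V → V → ℝ`; only their values on edges of the triangulation are ever used. -/

/-- The edge lengths `ℓ_ij = d_ij + d_ji`. -/
def edgeLength (d : V → V → ℝ) : Sym2 V → ℝ :=
  Sym2.lift ⟨fun i j => d i j + d j i, fun _ _ => add_comm _ _⟩

/-- `s` is a nondegenerate triangle in the Euclidean plane, with vertices `v_i`, `v_j`, `v_k` in
this order, that realizes the edge lengths `ℓ` of `{i, j, k}`. -/
def IsEmbedding (ℓ : Sym2 V → ℝ) (i j k : V)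
    (s : Affine.Triangle ℝ (EuclideanSpace ℝ (Fin 2))) : Prop :=
  dist (s.points 0) (s.points 1) = ℓ s(i, j) ∧
  dist (s.points 1) (s.points 2) = ℓ s(j, k) ∧
  dist (s.points 2) (s.points 0) = ℓ s(k, i)

/-- `(M, T, ℓ)` is a piecewise flat surface: every simplex embeds as a nondegenerate Euclidean
simplex with edge lengths given by `ℓ` (every edge is a side of some triangle). -/
def IsPiecewiseFlat (S : TriangulatedSurface V) (ℓ : Sym2 V → ℝ) : Prop :=
  ∀ i j k, S.IsTriangle i j k → ∃ s, IsEmbedding ℓ i j k s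

/-- `d` is a piecewise flat metric, i.e. `(M, T, d)` is a piecewise flat, metrized surface. -/
structure IsMetric (S : TriangulatedSurface V) (d : V → V → ℝ) : Prop where
  piecewiseFlat : IsPiecewiseFlat S (edgeLength d)
  compatible : ∀ i j k, S.IsTriangle i j k →
    d i j ^ 2 + d j k ^ 2 + d k i ^ 2 = d j i ^ 2 + d i k ^ 2 + d k j ^ 2

/-- The angle `γ_{i,jk}` at vertex `i` of the triangle `{i, j, k}`, by the law of cosines. -/
def angle (ℓ : Sym2 V → ℝ) (i j k : V) : ℝ :=
  Real.arccos ((ℓ s(i, j) ^ 2 + ℓ s(i, k) ^ 2 - ℓ s(j, k) ^ 2) / (2 * ℓ s(i, j) * ℓ s(i, k)))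

/-- The curvature `K_i = 2π - ∑ γ_{i,jk}`, the sum being over the triangles at `i`.  The double sum
meets each triangle `{i, j, k}` twice, as `(j, k)` and as `(k, j)`, whence the factor `1 / 2`. -/
def curvature (S : TriangulatedSurface V) (ℓ : Sym2 V → ℝ) (i : V) : ℝ :=
  2 * Real.pi - (1 / 2) * ∑ j, ∑ k, if S.IsTriangle i j k then angle ℓ i j k else 0

/-- The signed distance `h_{ij,k}` from the center of the triangle `{i, j, k}` to the center of its
edge `{i, j}`. -/
def height (d : V → V → ℝ) (i j k : V) : ℝ :=
  (d i k - d i j * Real.cos (angle (edgeLength d) i j k)) /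
    Real.sin (angle (edgeLength d) i j k)

/-- The dual length `ℓ*_ij`: the sum of `h_{ij,k}` over the two triangles `{i, j, k}` at the edge
`{i, j}`. -/
def dualLength (S : TriangulatedSurface V) (d : V → V → ℝ) (i j : V) : ℝ :=
  ∑ k, if S.IsTriangle i j k then height d i j k else 0

/-- For a triangle `s` with vertices `v_i`, `v_j`, `v_k`, the point `c` is the center `c_ijk`: its
orthogonal projection to each side is the center of that side.  The center `c_ij` of a side is the
point on the line `v_i v_j` at signed distance `d_ij` from `v_i` and `d_ji` from `v_j`. -/
def IsCenter (d : V → V → ℝ) (i j k : V) (s : Affine.Triangle ℝ (EuclideanSpace ℝ (Fin 2)))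
    (c : EuclideanSpace ℝ (Fin 2)) : Prop :=
  inner ℝ (c - AffineMap.lineMap (s.points 0) (s.points 1) (d i j / edgeLength d s(i, j)))
    (s.points 1 - s.points 0) = 0 ∧
  inner ℝ (c - AffineMap.lineMap (s.points 1) (s.points 2) (d j k / edgeLength d s(j, k)))
    (s.points 2 - s.points 1) = 0 ∧
  inner ℝ (c - AffineMap.lineMap (s.points 2) (s.points 0) (d k i / edgeLength d s(k, i)))
    (s.points 0 - s.points 2) = 0

/-- A conformal structure on the open set `U` of functions on the vertices: a smooth map from `U`
to the piecewise flat metrics with `∂ℓ_ij/∂f_i = d_ij`, and `∂d_ij/∂f_k = 0` for `k ≠ i, j`. -/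
structure IsConformalStructure (S : TriangulatedSurface V) (U : Set (V → ℝ))
    (C : (V → ℝ) → V → V → ℝ) : Prop where
  isOpen : IsOpen U
  smooth : ∀ i j, S.skeleton.Adj i j → ContDiffOn ℝ ∞ (fun f => C f i j) U
  isMetric : ∀ f ∈ U, IsMetric S (C f)
  length_deriv : ∀ f ∈ U, ∀ i j, S.skeleton.Adj i j →
    HasLineDerivAt ℝ (fun g => edgeLength (C g) s(i, j)) (C f i j) f (Pi.single i 1)
  deriv_eq_zero : ∀ f ∈ U, ∀ i j k, S.skeleton.Adj i j → k ≠ i → k ≠ j →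
    HasLineDerivAt ℝ (fun g => C g i j) 0 f (Pi.single k 1)

/-- A conformal variation `f : (-ε, ε) → V(T)*` of `(M, T, d)` with extension `C` on `U`. -/
structure IsConformalVariation (S : TriangulatedSurface V) (d : V → V → ℝ) (U : Set (V → ℝ))
    (C : (V → ℝ) → V → V → ℝ) (ε : ℝ) (f : ℝ → V → ℝ) : Prop where
  pos : 0 < ε
  conformal : IsConformalStructure S U C
  smooth : ContDiffOn ℝ ∞ f (Set.Ioo (-ε) ε)
  mapsTo : Set.MapsTo f (Set.Ioo (-ε) ε) U
  init : ∀ i j, S.skeleton.Adj i j → C (f 0) i j = d i j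

/-- `(M, T, d)` is rigid with respect to conformal variations: the only conformal variations that
keep all curvatures fixed are those that scale all edge lengths by a common factor. -/
def IsConformallyRigid (S : TriangulatedSurface V) (d : V → V → ℝ) : Prop :=
  ∀ (U : Set (V → ℝ)) (C : (V → ℝ) → V → V → ℝ) (ε : ℝ) (f : ℝ → V → ℝ),
    IsConformalVariation S d U C ε f →
    (∀ t ∈ Set.Ioo (-ε) ε, ∀ i,
      curvature S (edgeLength (C (f t))) i = curvature S (edgeLength d) i) →
    ∀ t ∈ Set.Ioo (-ε) ε, ∃ c : ℝ, 0 < c ∧ ∀ i j, S.skeleton.Adj i j →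
      edgeLength (C (f t)) s(i, j) = c * edgeLength d s(i, j)

/-- All dual lengths are positive. -/
def HasPositiveDualLengths (S : TriangulatedSurface V) (d : V → V → ℝ) : Prop :=
  ∀ i j, S.skeleton.Adj i j → 0 < dualLength S d i j

/-- `d` belongs to a fixed inversive distance conformal structure with all `η_ij ≥ 0`; here
`exp f_i` are the radii of the circles at the vertices. -/
def IsNonnegInversiveDistance (S : TriangulatedSurface V) (d : V → V → ℝ) : Prop :=
  ∃ (η : Sym2 V → ℝ) (f : V → ℝ), ∀ i j, S.skeleton.Adj i j →
    0 ≤ η s(i, j) ∧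
    d i j = Real.exp (f i) * (Real.exp (f i) + Real.exp (f j) * η s(i, j)) /
      Real.sqrt (Real.exp (2 * f i) + Real.exp (2 * f j) +
        2 * Real.exp (f i) * Real.exp (f j) * η s(i, j))

/-- `d_ij > 0` for every directed edge. -/
def HasPositiveWeights (S : TriangulatedSurface V) (d : V → V → ℝ) : Prop :=
  ∀ i j, S.skeleton.Adj i j → 0 < d i j

/-- `d` belongs to a perpendicular bisector conformal structure. -/
def IsPerpendicularBisector (S : TriangulatedSurface V) (d : V → V → ℝ) : Prop :=
  ∃ (L : Sym2 V → ℝ) (f : V → ℝ), IsPiecewiseFlat S L ∧ ∀ i j, S.skeleton.Adj i j →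
    d i j = 1 / 2 * Real.exp (1 / 2 * (f i + f j)) * L s(i, j)

/-- In every triangle embedded isometrically in the plane, the center lies inside the
circumcircle. -/
def HasCentersInCircumcircles (S : TriangulatedSurface V) (d : V → V → ℝ) : Prop :=
  ∀ i j k, S.IsTriangle i j k → ∀ s, IsEmbedding (edgeLength d) i j k s →
    ∃ c, IsCenter d i j k s c ∧ dist c s.circumcenter < s.circumradius

end PiecewiseFlat

end

/-! Let `x` be the velocity of a conformal variation. The law of cosines and the compatibility
condition give the angle at `i` the derivative `w_ij (x_j - x_i) + w_ik (x_k - x_i)` with `w = h /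
ℓ` (`hasDerivAt_angle`). Constant curvature thus makes `x` harmonic for a symmetric discrete
Laplacian, and summation by parts kills its Dirichlet energy. Positive dual lengths make every edge
term of this energy nonnegative. Under the other hypotheses the energy splits into one ternary form
per triangle. Such a form is definite modulo constants once `pedalRatio` is positive, because its
value on the vertex coordinates is twice the area. Positivity of `pedalRatio` is algebra when `d >
0`, which covers nonnegative inversive distances. For perpendicular bisectors the ratio is `1 / 4`,
and for centers inside the circumcircle it is a positive multiple of minus the power of the center.
In either case `x` is constant on the connected surface. Symmetry of the second derivatives of `ℓ`
makes each `d_ij` homogeneous under constant shifts of `f`, so all of `d` changes at one common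
rate. Definiteness is assumed only at the initial metric, but it is open and scale invariant
(`HasDefiniteLaplacian.eventually`, `HasDefiniteLaplacian.scale`). Hence the times at which the
metric is a multiple of the initial one form an open and closed set
(`IsConformalVariation.eq_scale`). -/

noncomputable section

/-! ### Combinatorics of triangles and edges. -/

namespace TriangulatedSurface

variable {V : Type*} [Fintype V] [DecidableEq V] {S : TriangulatedSurface V} {i j k : V}

theorem IsTriangle.rotate (h : S.IsTriangle i j k) : S.IsTriangle j k i := by
  have : ({j, k, i} : Finset V) = {i, j, k} := by ext; simp; tauto
  unfold IsTriangle
  rwa [this]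

theorem IsTriangle.swap_right (h : S.IsTriangle i j k) : S.IsTriangle i k j := by
  have : ({i, k, j} : Finset V) = {i, j, k} := by ext; simp; tauto
  unfold IsTriangle
  rwa [this]

theorem IsTriangle.swap_left (h : S.IsTriangle i j k) : S.IsTriangle j i k :=
  h.rotate.swap_right

theorem IsTriangle.ne (h : S.IsTriangle i j k) : i ≠ j := by
  rintro rfl
  have h3 := S.card_triangle _ h
  have := Finset.card_le_two (a := i) (b := k)
  simp at h3
  omega

theorem IsTriangle.adj (h : S.IsTriangle i j k) : S.skeleton.Adj i j :=
  ⟨h.ne, _, h, by simp, by simp⟩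

theorem exists_isTriangle (h : S.skeleton.Adj i j) : ∃ k, S.IsTriangle i j k := by
  obtain ⟨hij, t, ht, hi, hj⟩ := h
  have h1 : ((t.erase i).erase j).card = 1 := by
    rw [Finset.card_erase_of_mem (by simp [hj, hij.symm]), Finset.card_erase_of_mem hi,
      S.card_triangle t ht]
  obtain ⟨k, hk⟩ := Finset.card_eq_one.1 h1
  refine ⟨k, ?_⟩
  have : ({i, j, k} : Finset V) = t := by
    rw [← hk, Finset.insert_erase (by simp [hj, hij.symm]), Finset.insert_erase hi]
  unfold IsTriangle
  rwa [this]

end TriangulatedSurface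

/-! ### Euclidean triangles: inner products and areas. -/

namespace PiecewiseFlat

variable {V : Type*}

theorem edgeLength_mk (d : V → V → ℝ) (i j : V) : edgeLength d s(i, j) = d i j + d j i := rfl

/-- The inner product of the sides `v_i v_j` and `v_i v_k` of the triangle `{i, j, k}`. -/
def sideInner (ℓ : Sym2 V → ℝ) (i j k : V) : ℝ :=
  (ℓ s(i, j) ^ 2 + ℓ s(i, k) ^ 2 - ℓ s(j, k) ^ 2) / 2

/-- Twice the area of the triangle `{i, j, k}`. -/
def doubleArea (ℓ : Sym2 V → ℝ) (i j k : V) : ℝ :=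
  √((ℓ s(i, j) * ℓ s(i, k)) ^ 2 - sideInner ℓ i j k ^ 2)

theorem doubleArea_swap_right (ℓ : Sym2 V → ℝ) (i j k : V) :
    doubleArea ℓ i k j = doubleArea ℓ i j k := by
  unfold doubleArea sideInner
  rw [Sym2.eq_swap (a := k) (b := j)]
  ring_nf

theorem doubleArea_swap_left (ℓ : Sym2 V → ℝ) (i j k : V) :
    doubleArea ℓ j i k = doubleArea ℓ i j k := by
  unfold doubleArea sideInner
  rw [Sym2.eq_swap (a := j) (b := i)]
  ring_nf

theorem inner_sub_eq {ℓ : Sym2 V → ℝ} {i j k : V}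
    {s : Affine.Triangle ℝ (EuclideanSpace ℝ (Fin 2))} (h : IsEmbedding ℓ i j k s) :
    inner ℝ (s.points 1 - s.points 0) (s.points 2 - s.points 0) = sideInner ℓ i j k := by
  obtain ⟨h1, h2, h3⟩ := h
  rw [Sym2.eq_swap] at h3
  rw [dist_comm, dist_eq_norm] at h1 h2
  rw [dist_eq_norm] at h3
  have := norm_sub_sq_real (s.points 1 - s.points 0) (s.points 2 - s.points 0)
  rw [sub_sub_sub_cancel_right, norm_sub_rev, h2, h1, h3] at this
  unfold sideInner
  linarith

theorem IsEmbedding.length_pos {ℓ : Sym2 V → ℝ} {i j k : V}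
    {s : Affine.Triangle ℝ (EuclideanSpace ℝ (Fin 2))} (h : IsEmbedding ℓ i j k s) :
    0 < ℓ s(i, j) := by
  rw [← h.1]
  exact dist_pos.2 (s.independent.injective.ne (by decide))

/-- Strict Cauchy–Schwarz for two linearly independent sides. -/
theorem IsEmbedding.sideInner_sq_lt {ℓ : Sym2 V → ℝ} {i j k : V}
    {s : Affine.Triangle ℝ (EuclideanSpace ℝ (Fin 2))} (h : IsEmbedding ℓ i j k s) :
    sideInner ℓ i j k ^ 2 < (ℓ s(i, j) * ℓ s(i, k)) ^ 2 := by
  have h1 := h.1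
  have h3 := h.2.2
  rw [Sym2.eq_swap, dist_eq_norm] at h3
  rw [dist_comm, dist_eq_norm] at h1
  rw [← inner_sub_eq h, ← h1, ← h3]
  have hli := (affineIndependent_iff_linearIndependent_vsub ℝ s.points 0).1 s.independent
  have hli2 : LinearIndependent ℝ ![s.points 1 - s.points 0, s.points 2 - s.points 0] := by
    have := hli.comp (![⟨1, by decide⟩, ⟨2, by decide⟩] : Fin 2 → {x : Fin 3 // x ≠ 0})
      (by decide)
    have he : (fun a : {x : Fin 3 // x ≠ 0} => (s.points a -ᵥ s.points 0 : EuclideanSpace ℝ (Fin 2))) ∘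
        (![⟨1, by decide⟩, ⟨2, by decide⟩] : Fin 2 → {x : Fin 3 // x ≠ 0}) =
        ![s.points 1 - s.points 0, s.points 2 - s.points 0] := by
      ext a : 1
      fin_cases a <;> rfl
    exact he ▸ this
  rw [LinearIndependent.pair_iff] at hli2
  have hp : s.points 1 - s.points 0 ≠ 0 := sub_ne_zero.2 (s.independent.injective.ne (by decide))
  generalize s.points 1 - s.points 0 = p at *
  generalize s.points 2 - s.points 0 = q at *
  have hp2 : 0 < ‖p‖ ^ 2 := by positivity
  -- This vector has squared norm `‖p‖² (‖p‖² ‖q‖² - ⟪p, q⟫²)`.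
  have hne : inner ℝ p q • p - ‖p‖ ^ 2 • q ≠ 0 := fun h0 => by
    have := hli2 (inner ℝ p q) (-‖p‖ ^ 2) (by rw [neg_smul, ← sub_eq_add_neg, h0])
    linarith [this.2]
  have hpos : 0 < ‖inner ℝ p q • p - ‖p‖ ^ 2 • q‖ ^ 2 := by positivity
  rw [norm_sub_sq_real, norm_smul, norm_smul, real_inner_smul_left, real_inner_smul_right,
    mul_pow, mul_pow, Real.norm_eq_abs, Real.norm_eq_abs, sq_abs, sq_abs] at hpos
  have : 0 < ‖p‖ ^ 2 * ((‖p‖ * ‖q‖) ^ 2 - inner ℝ p q ^ 2) := by nlinarith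
  have := (mul_pos_iff_of_pos_left hp2).1 this
  linarith

/-! ### Dual weights of a triangle. -/

variable [Fintype V] [DecidableEq V] {S : TriangulatedSurface V} {i j k : V}

/-- The weight `h_ij,k / ℓ_ij` that the triangle `{i, j, k}` gives to its edge `{i, j}`. -/
def dualWeight (d : V → V → ℝ) (i j k : V) : ℝ :=
  height d i j k / edgeLength d s(i, j)

theorem IsPiecewiseFlat.length_pos {ℓ : Sym2 V → ℝ} (hℓ : IsPiecewiseFlat S ℓ)
    (hT : S.IsTriangle i j k) : 0 < ℓ s(i, j) :=
  (hℓ i j k hT).choose_spec.length_pos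

theorem IsPiecewiseFlat.sideInner_sq_lt {ℓ : Sym2 V → ℝ} (hℓ : IsPiecewiseFlat S ℓ)
    (hT : S.IsTriangle i j k) : sideInner ℓ i j k ^ 2 < (ℓ s(i, j) * ℓ s(i, k)) ^ 2 :=
  (hℓ i j k hT).choose_spec.sideInner_sq_lt

theorem IsPiecewiseFlat.doubleArea_pos {ℓ : Sym2 V → ℝ} (hℓ : IsPiecewiseFlat S ℓ)
    (hT : S.IsTriangle i j k) : 0 < doubleArea ℓ i j k :=
  Real.sqrt_pos.2 (sub_pos.2 (hℓ.sideInner_sq_lt hT))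

theorem IsPiecewiseFlat.doubleArea_sq {ℓ : Sym2 V → ℝ} (hℓ : IsPiecewiseFlat S ℓ)
    (hT : S.IsTriangle i j k) :
    doubleArea ℓ i j k ^ 2 = (ℓ s(i, j) * ℓ s(i, k)) ^ 2 - sideInner ℓ i j k ^ 2 :=
  Real.sq_sqrt (sub_pos.2 (hℓ.sideInner_sq_lt hT)).le

omit [Fintype V] [DecidableEq V] in
theorem angle_eq (ℓ : Sym2 V → ℝ) (i j k : V) :
    angle ℓ i j k = Real.arccos (sideInner ℓ i j k / (ℓ s(i, j) * ℓ s(i, k))) := by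
  unfold angle sideInner
  rw [div_div, mul_assoc]

theorem IsPiecewiseFlat.cos_angle {ℓ : Sym2 V → ℝ} (hℓ : IsPiecewiseFlat S ℓ)
    (hT : S.IsTriangle i j k) :
    Real.cos (angle ℓ i j k) = sideInner ℓ i j k / (ℓ s(i, j) * ℓ s(i, k)) := by
  have hpos := mul_pos (hℓ.length_pos hT) (hℓ.length_pos hT.swap_right)
  have h := abs_lt_of_sq_lt_sq' (hℓ.sideInner_sq_lt hT) hpos.le
  rw [angle_eq, Real.cos_arccos]
  · rw [le_div_iff₀ hpos]
    linarith
  · rw [div_le_one hpos]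
    exact h.2.le

theorem IsPiecewiseFlat.sin_angle {ℓ : Sym2 V → ℝ} (hℓ : IsPiecewiseFlat S ℓ)
    (hT : S.IsTriangle i j k) :
    Real.sin (angle ℓ i j k) = doubleArea ℓ i j k / (ℓ s(i, j) * ℓ s(i, k)) := by
  have hpos := mul_pos (hℓ.length_pos hT) (hℓ.length_pos hT.swap_right)
  rw [angle_eq, Real.sin_arccos, Real.sqrt_eq_iff_mul_self_eq_of_pos
    (div_pos (hℓ.doubleArea_pos hT) hpos), ← sq, div_pow, hℓ.doubleArea_sq hT, div_pow,
    sub_div, div_self (pow_ne_zero 2 hpos.ne')]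

theorem IsPiecewiseFlat.dualWeight_eq {d : V → V → ℝ} (hd : IsPiecewiseFlat S (edgeLength d))
    (hT : S.IsTriangle i j k) :
    dualWeight d i j k =
      (edgeLength d s(i, j) * edgeLength d s(i, k) * d i k -
        d i j * sideInner (edgeLength d) i j k) /
        (edgeLength d s(i, j) * doubleArea (edgeLength d) i j k) := by
  have h1 := (hd.length_pos hT).ne'
  have h2 := (hd.length_pos hT.swap_right).ne'
  have h3 := (hd.doubleArea_pos hT).ne'
  unfold dualWeight height
  rw [hd.cos_angle hT, hd.sin_angle hT]
  field_simp

section Metric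

variable {d : V → V → ℝ}

/-- The compatibility condition says that the perpendiculars at the three edge centers are
concurrent, so the height over an edge does not depend on the endpoint from which it is computed. -/
theorem IsMetric.dualWeight_swap (hd : IsMetric S d) (hT : S.IsTriangle i j k) :
    dualWeight d j i k = dualWeight d i j k := by
  have h1 := (hd.piecewiseFlat.length_pos hT).ne'
  have h3 := (hd.piecewiseFlat.doubleArea_pos hT).ne'
  have hc := hd.compatible i j k hT
  rw [hd.piecewiseFlat.dualWeight_eq hT, hd.piecewiseFlat.dualWeight_eq hT.swap_left,
    doubleArea_swap_left, Sym2.eq_swap (a := j) (b := i)]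
  congr 1
  unfold sideInner
  simp only [edgeLength_mk]
  grind

/-- Each term `ℓ² w = ℓ h` is twice the signed area of the triangle spanned by an edge and the
center; the three pieces make up the whole triangle. -/
theorem IsMetric.sum_length_sq_mul_dualWeight (hd : IsMetric S d) (hT : S.IsTriangle i j k) :
    edgeLength d s(i, j) ^ 2 * dualWeight d i j k + edgeLength d s(j, k) ^ 2 * dualWeight d j k i +
      edgeLength d s(i, k) ^ 2 * dualWeight d i k j = doubleArea (edgeLength d) i j k := by
  have h1 := (hd.piecewiseFlat.length_pos hT)
  have h2 := (hd.piecewiseFlat.length_pos hT.rotate)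
  have h3 := (hd.piecewiseFlat.length_pos hT.swap_right)
  have h4 := (hd.piecewiseFlat.doubleArea_pos hT)
  have h5 := (hd.piecewiseFlat.doubleArea_sq hT)
  have hc := hd.compatible i j k hT
  rw [hd.piecewiseFlat.dualWeight_eq hT, hd.piecewiseFlat.dualWeight_eq hT.rotate,
    hd.piecewiseFlat.dualWeight_eq hT.swap_right, doubleArea_swap_right _ i j k,
    doubleArea_swap_right _ j i k, doubleArea_swap_left _ i j k]
  generalize doubleArea (edgeLength d) i j k = Δ at *
  unfold sideInner at *
  rw [Sym2.eq_swap (a := j) (b := i), Sym2.eq_swap (a := k) (b := i),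
    Sym2.eq_swap (a := k) (b := j)]
  field_simp
  rw [h5]
  simp only [edgeLength_mk]
  grind

end Metric

/-! ### Variation of the angles. -/

theorem hasDerivAt_angle {D : ℝ → V → V → ℝ} {t : ℝ} {x : V → ℝ} (hd : IsMetric S (D t))
    (hD : ∀ i j, S.skeleton.Adj i j →
      HasDerivAt (fun τ => edgeLength (D τ) s(i, j)) (D t i j * x i + D t j i * x j) t)
    (hT : S.IsTriangle i j k) :
    HasDerivAt (fun τ => angle (edgeLength (D τ)) i j k)
      (dualWeight (D t) i j k * (x j - x i) + dualWeight (D t) i k j * (x k - x i)) t := by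
  have hℓ := hd.piecewiseFlat
  have h1 := hℓ.length_pos hT
  have h2 := hℓ.length_pos hT.swap_right
  have h4 := hℓ.doubleArea_pos hT
  have hpos := mul_pos h1 h2
  have hc := hd.compatible i j k hT
  have habs := abs_lt_of_sq_lt_sq' (hℓ.sideInner_sq_lt hT) hpos.le
  have hu := hD i j hT.adj
  have hv := hD i k hT.swap_right.adj
  have hw := hD j k hT.rotate.adj
  have hg := ((((hu.pow 2).add (hv.pow 2)).sub (hw.pow 2)).div_const 2).div (hu.mul hv) hpos.ne'
  have hs := hℓ.sin_angle hT
  rw [angle_eq, Real.sin_arccos] at hs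
  have hne1 : sideInner (edgeLength (D t)) i j k /
      (edgeLength (D t) s(i, j) * edgeLength (D t) s(i, k)) ≠ -1 := by
    intro h
    rw [div_eq_iff hpos.ne'] at h
    linarith [habs.1]
  have hne2 : sideInner (edgeLength (D t)) i j k /
      (edgeLength (D t) s(i, j) * edgeLength (D t) s(i, k)) ≠ 1 := by
    intro h
    rw [div_eq_iff hpos.ne'] at h
    linarith [habs.2]
  -- Nondegeneracy keeps the cosine away from `±1`, where `arccos` is not differentiable.
  have hA := (Real.hasDerivAt_arccos hne1 hne2).comp t hg
  simp only [angle_eq]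
  refine hA.congr_deriv ?_
  rw [hs, hℓ.dualWeight_eq hT, hℓ.dualWeight_eq hT.swap_right, doubleArea_swap_right _ i j k]
  simp only [Pi.add_apply, Pi.pow_apply, Pi.sub_apply, Pi.mul_apply]
  generalize doubleArea (edgeLength (D t)) i j k = Δ at *
  unfold sideInner
  rw [Sym2.eq_swap (a := k) (b := j)]
  field_simp
  simp only [edgeLength_mk]
  grind

/-! ### Dirichlet energy and harmonic functions. -/

/-- A quadratic form `u (x - y)² + v (y - z)² + w (x - z)²` with `uv + vw + wu > 0` is positive
definite modulo constants if it takes a positive value on the coordinates of some triangle. -/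
theorem add_pos_of_triangle {u v w a b g : ℝ} (hσ : 0 < u * v + v * w + w * u)
    (hab : 0 < a) (hg : g ^ 2 < (a * b) ^ 2)
    (htr : 0 < a ^ 2 * u + (a ^ 2 + b ^ 2 - 2 * g) * v + b ^ 2 * w) : 0 < u + v := by
  by_contra! hm
  have h1 : (u + v) * (a ^ 2 * u + (a ^ 2 + b ^ 2 - 2 * g) * v + b ^ 2 * w) ≤ 0 :=
    mul_nonpos_of_nonpos_of_nonneg hm htr.le
  have hb : b ≠ 0 := by
    rintro rfl
    nlinarith [sq_nonneg g]
  have h2 : 0 < a ^ 2 * b ^ 2 * (u * v + v * w + w * u) := by positivity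
  have h3 : 0 ≤ v ^ 2 * ((a * b) ^ 2 - g ^ 2) := mul_nonneg (sq_nonneg v) (by linarith)
  -- With `T` the value on the triangle, `a² (u + v) T = (a² (u + v) - g v)² + v² (a² b² - g²) + a²
  -- b² (uv + vw + wu)`, so `u + v ≤ 0` is impossible.
  nlinarith [sq_nonneg (a ^ 2 * (u + v) - g * v), mul_nonpos_of_nonneg_of_nonpos (sq_nonneg a) h1]

theorem quadratic_nonneg {u v w : ℝ} (hσ : 0 < u * v + v * w + w * u) (huv : 0 < u + v)
    (x y z : ℝ) : 0 ≤ u * (x - y) ^ 2 + v * (y - z) ^ 2 + w * (x - z) ^ 2 := by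
  have h : (u + v) * (u * (x - y) ^ 2 + v * (y - z) ^ 2 + w * (x - z) ^ 2) =
      ((u + v) * (y - z) - u * (x - z)) ^ 2 + (u * v + v * w + w * u) * (x - z) ^ 2 := by ring
  exact nonneg_of_mul_nonneg_right (h ▸ by positivity) huv

theorem eq_of_quadratic_eq_zero {u v w : ℝ} (hσ : 0 < u * v + v * w + w * u) {x y z : ℝ}
    (huv : 0 < u + v) (h0 : u * (x - y) ^ 2 + v * (y - z) ^ 2 + w * (x - z) ^ 2 = 0) : x = y := by
  have h : (u + v) * (u * (x - y) ^ 2 + v * (y - z) ^ 2 + w * (x - z) ^ 2) =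
      ((u + v) * (y - z) - u * (x - z)) ^ 2 + (u * v + v * w + w * u) * (x - z) ^ 2 := by ring
  rw [h0, mul_zero] at h
  have h1 : (u * v + v * w + w * u) * (x - z) ^ 2 = 0 := by
    have := mul_nonneg hσ.le (sq_nonneg (x - z))
    linarith [sq_nonneg ((u + v) * (y - z) - u * (x - z))]
  have hx : x - z = 0 := by simpa [hσ.ne'] using h1
  have hy : y - z = 0 := by simpa [hx, huv.ne'] using h.symm
  linarith

variable {d : V → V → ℝ}

/-- The second elementary symmetric function of the weights of the triangle `{i, j, k}`; it is the
ratio of the area of the pedal triangle of the center to the area of the triangle. -/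
def pedalRatio (d : V → V → ℝ) (i j k : V) : ℝ :=
  dualWeight d i j k * dualWeight d j k i + dualWeight d j k i * dualWeight d i k j +
    dualWeight d i k j * dualWeight d i j k

/-- Either the discrete Laplacian has positive weights, or the contribution of each triangle to it
is definite modulo constants. -/
def HasDefiniteLaplacian (S : TriangulatedSurface V) (d : V → V → ℝ) : Prop :=
  HasPositiveDualLengths S d ∨ ∀ i j k, S.IsTriangle i j k → 0 < pedalRatio d i j k

theorem IsMetric.dualWeight_add_pos (hd : IsMetric S d) (hT : S.IsTriangle i j k)
    (hσ : 0 < pedalRatio d i j k) : 0 < dualWeight d i j k + dualWeight d j k i := by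
  refine add_pos_of_triangle hσ (hd.piecewiseFlat.length_pos hT)
    (hd.piecewiseFlat.sideInner_sq_lt hT) ?_
  have h := hd.sum_length_sq_mul_dualWeight hT
  have h2 := hd.piecewiseFlat.doubleArea_pos hT
  rw [← h] at h2
  convert h2 using 4
  unfold sideInner
  ring

/-- Summation by parts: the Laplacian of `x` is paired with `x`, and symmetry of the weights merges
the two orientations of each edge. -/
theorem IsMetric.sum_dualWeight_mul_sq (hd : IsMetric S d) {x : V → ℝ}
    (hx : ∀ i, ∑ j, ∑ k, (if S.IsTriangle i j k then
      dualWeight d i j k * (x j - x i) + dualWeight d i k j * (x k - x i) else 0) = 0) :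
    ∑ i, ∑ j, ∑ k, (if S.IsTriangle i j k then dualWeight d i j k * (x i - x j) ^ 2 else 0) = 0 := by
  set F : V → V → V → ℝ := fun i j k =>
    if S.IsTriangle i j k then dualWeight d i j k * (x j - x i) else 0 with hF
  have hF0 : ∀ i, ∑ j, ∑ k, F i j k = 0 := fun i => by
    -- Exchanging `j` and `k` identifies the two summands, so the hypothesis is twice the vanishing
    -- of the sum of `F i`.
    have h1 : ∑ j, ∑ k, (if S.IsTriangle i j k then
        dualWeight d i j k * (x j - x i) + dualWeight d i k j * (x k - x i) else 0) =
        ∑ j, ∑ k, F i j k + ∑ j, ∑ k, F i k j := by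
      simp only [← Finset.sum_add_distrib]
      refine Finset.sum_congr rfl fun j _ => Finset.sum_congr rfl fun k _ => ?_
      simp only [hF]
      by_cases h : S.IsTriangle i j k
      · rw [if_pos h, if_pos h, if_pos h.swap_right]
      · rw [if_neg h, if_neg h, if_neg fun h' => h h'.swap_right, add_zero]
    rw [hx i, Finset.sum_comm (f := fun j k => F i k j)] at h1
    linarith
  have h2 : ∀ i j k, (if S.IsTriangle i j k then dualWeight d i j k * (x i - x j) ^ 2 else 0) =
      -(x i * F i j k) - x j * F j i k := fun i j k => by
    simp only [hF]
    by_cases h : S.IsTriangle i j k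
    · rw [if_pos h, if_pos h, if_pos h.swap_left, hd.dualWeight_swap h]
      ring
    · rw [if_neg h, if_neg h, if_neg fun h' => h h'.swap_left]
      ring
  have h3 : ∑ i, ∑ j, ∑ k, x i * F i j k = 0 := by
    simp only [← Finset.mul_sum, hF0, mul_zero, Finset.sum_const_zero]
  simp only [h2, Finset.sum_sub_distrib, Finset.sum_neg_distrib, h3]
  rw [Finset.sum_comm, h3]
  simp

theorem IsMetric.eq_of_adj_of_stationary (hd : IsMetric S d) (hL : HasDefiniteLaplacian S d)
    {x : V → ℝ}
    (hx : ∀ i, ∑ j, ∑ k, (if S.IsTriangle i j k then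
      dualWeight d i j k * (x j - x i) + dualWeight d i k j * (x k - x i) else 0) = 0)
    (hij : S.skeleton.Adj i j) : x i = x j := by
  have hsum := hd.sum_dualWeight_mul_sq hx
  rcases hL with hL | hL
  · have hE : ∀ i j, ∑ k, (if S.IsTriangle i j k then dualWeight d i j k * (x i - x j) ^ 2 else 0)
        = dualLength S d i j / edgeLength d s(i, j) * (x i - x j) ^ 2 := fun i j => by
      rw [dualLength, Finset.sum_div, Finset.sum_mul]
      refine Finset.sum_congr rfl fun k _ => ?_
      unfold dualWeight
      split_ifs <;> simp
    have hpos : ∀ {i j}, S.skeleton.Adj i j → 0 < dualLength S d i j / edgeLength d s(i, j) :=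
      fun {i j} h => div_pos (hL i j h)
        (hd.piecewiseFlat.length_pos (TriangulatedSurface.exists_isTriangle h).choose_spec)
    have hnn : ∀ i j, 0 ≤ dualLength S d i j / edgeLength d s(i, j) * (x i - x j) ^ 2 :=
      fun i j => by
        by_cases h : S.skeleton.Adj i j
        · exact mul_nonneg (hpos h).le (sq_nonneg _)
        · rw [← hE]
          refine (Finset.sum_eq_zero fun k _ => if_neg fun hT => h hT.adj).ge
    simp only [hE] at hsum
    rw [Finset.sum_eq_zero_iff_of_nonneg fun i _ => Finset.sum_nonneg fun j _ => hnn i j] at hsum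
    have h1 := hsum i (Finset.mem_univ i)
    rw [Finset.sum_eq_zero_iff_of_nonneg fun j _ => hnn i j] at h1
    have h2 := h1 j (Finset.mem_univ j)
    rw [mul_eq_zero, or_iff_right (hpos hij).ne', sq_eq_zero_iff] at h2
    linarith
  · set G : V → V → V → ℝ := fun i j k =>
      if S.IsTriangle i j k then dualWeight d i j k * (x i - x j) ^ 2 else 0 with hG
    -- Relabelling the vertices collects the terms of all three edges of a triangle in one summand,
    -- which is then the ternary form of that triangle.
    have h1 : ∑ i, ∑ j, ∑ k, G j k i = 0 := by
      rw [Finset.sum_comm, ← hsum]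
      exact Finset.sum_congr rfl fun j _ => Finset.sum_comm
    have h2 : ∑ i, ∑ j, ∑ k, G i k j = 0 := by
      rw [← hsum]
      exact Finset.sum_congr rfl fun j _ => Finset.sum_comm
    have h3 : ∑ i, ∑ j, ∑ k, (G i j k + G j k i + G i k j) = 0 := by
      simp only [Finset.sum_add_distrib]
      linarith
    have hQ : ∀ {i j k}, S.IsTriangle i j k → G i j k + G j k i + G i k j =
        dualWeight d i j k * (x i - x j) ^ 2 + dualWeight d j k i * (x j - x k) ^ 2 +
          dualWeight d i k j * (x i - x k) ^ 2 := fun {i j k} hT => by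
      simp only [hG]
      rw [if_pos hT, if_pos hT.rotate, if_pos hT.swap_right]
    have hnn : ∀ i j k, 0 ≤ G i j k + G j k i + G i k j := fun i j k => by
      by_cases hT : S.IsTriangle i j k
      · rw [hQ hT]
        exact quadratic_nonneg (hL i j k hT) (hd.dualWeight_add_pos hT (hL i j k hT)) _ _ _
      · simp only [hG]
        rw [if_neg hT, if_neg fun h => hT h.rotate.rotate, if_neg fun h => hT h.swap_right]
        simp
    obtain ⟨k, hT⟩ := TriangulatedSurface.exists_isTriangle hij
    rw [Finset.sum_eq_zero_iff_of_nonneg fun i _ => Finset.sum_nonneg fun j _ =>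
      Finset.sum_nonneg fun k _ => hnn i j k] at h3
    have h4 := h3 i (Finset.mem_univ i)
    rw [Finset.sum_eq_zero_iff_of_nonneg fun j _ => Finset.sum_nonneg fun k _ => hnn i j k] at h4
    have h5 := h4 j (Finset.mem_univ j)
    rw [Finset.sum_eq_zero_iff_of_nonneg fun k _ => hnn i j k] at h5
    have h6 := h5 k (Finset.mem_univ k)
    rw [hQ hT] at h6
    exact eq_of_quadratic_eq_zero (hL i j k hT) (hd.dualWeight_add_pos hT (hL i j k hT)) h6

theorem IsMetric.eq_of_stationary (hS : S.skeleton.Connected) (hd : IsMetric S d)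
    (hL : HasDefiniteLaplacian S d) {x : V → ℝ}
    (hx : ∀ i, ∑ j, ∑ k, (if S.IsTriangle i j k then
      dualWeight d i j k * (x j - x i) + dualWeight d i k j * (x k - x i) else 0) = 0)
    (i j : V) : x i = x j := by
  obtain ⟨p⟩ := hS.preconnected i j
  induction p with
  | nil => rfl
  | cons h _ ih => exact (hd.eq_of_adj_of_stationary hL hx h).trans ih

/-! ### Positivity of the pedal ratio. -/

/-- In the plane an inner product is recovered from the components along `p` and `q` by inverting
their Gram matrix. -/
theorem gram_mul_inner (p q y o : EuclideanSpace ℝ (Fin 2)) :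
    (‖p‖ ^ 2 * ‖q‖ ^ 2 - inner ℝ p q ^ 2) * inner ℝ y o =
      ‖q‖ ^ 2 * inner ℝ y p * inner ℝ o p + ‖p‖ ^ 2 * inner ℝ y q * inner ℝ o q -
        inner ℝ p q * (inner ℝ y p * inner ℝ o q + inner ℝ y q * inner ℝ o p) := by
  simp only [EuclideanSpace.norm_sq_eq, PiLp.inner_apply, Fin.sum_univ_two, Real.norm_eq_abs,
    sq_abs, RCLike.inner_apply, conj_trivial]
  ring

/-- Here `u` is the weight of an edge of squared length `g₁ + g₂`, split by the foot of the
altitude, and `v`, `w` are the weights of the other two edges. The hypotheses `h₁` to `h₄` express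
positivity of the four `d` values based at its endpoints. They force `v, w > 0`, and then `w (g₁ v +
(g₁ + g₂) u) + v (g₂ w + (g₁ + g₂) u)` is `g₁ + g₂` times the claimed quantity. -/
theorem symm_two_pos_of_nonpos {u v w B C g₁ g₂ : ℝ} (hu : u ≤ 0) (hA : 0 < g₁ + g₂)
    (hB : g₁ ^ 2 < (g₁ + g₂) * B) (hC : g₂ ^ 2 < (g₁ + g₂) * C)
    (h₁ : 0 < g₁ * u + B * v) (h₂ : 0 < g₁ * v + (g₁ + g₂) * u)
    (h₃ : 0 < g₂ * u + C * w) (h₄ : 0 < g₂ * w + (g₁ + g₂) * u) :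
    0 < u * w + w * v + v * u := by
  have hAu : (g₁ + g₂) * u ≤ 0 := mul_nonpos_of_nonneg_of_nonpos hA.le hu
  have key : ∀ {B g v : ℝ}, g ^ 2 < (g₁ + g₂) * B → 0 < g * u + B * v →
      0 < g * v + (g₁ + g₂) * u → 0 < v := by
    intro B g v hB h h'
    by_contra! hv
    have hg : g ≤ 0 := by
      by_contra! hg
      linarith [mul_nonpos_of_nonneg_of_nonpos hg.le hv]
    have h1 := mul_pos hA h
    have h2 := mul_nonpos_of_nonpos_of_nonneg hg h'.le
    have h3 := mul_nonpos_of_nonneg_of_nonpos (sub_pos.2 hB).le hv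
    linarith
  have h5 := mul_pos (key hC h₃ h₄) h₂
  have h6 := mul_pos (key hB h₁ h₂) h₄
  have : 0 < (g₁ + g₂) * (u * w + w * v + v * u) := by linarith
  exact (mul_pos_iff_of_pos_left hA).1 this

omit [Fintype V] [DecidableEq V] in
theorem sideInner_swap (ℓ : Sym2 V → ℝ) (i j k : V) : sideInner ℓ i k j = sideInner ℓ i j k := by
  unfold sideInner
  rw [Sym2.eq_swap (a := k) (b := j)]
  ring

theorem IsMetric.pedalRatio_rotate (hd : IsMetric S d) (hT : S.IsTriangle i j k) :
    pedalRatio d j k i = pedalRatio d i j k := by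
  unfold pedalRatio
  rw [← hd.dualWeight_swap hT, ← hd.dualWeight_swap hT.rotate.rotate]
  ring

/-- Inverts the formula for the weights, so that the sign of `d` becomes a linear inequality in the
weights. -/
theorem IsMetric.mul_doubleArea (hd : IsMetric S d) (hT : S.IsTriangle i j k) :
    d i j * doubleArea (edgeLength d) i j k = edgeLength d s(i, j) *
      (sideInner (edgeLength d) i j k * dualWeight d i j k +
        edgeLength d s(i, k) ^ 2 * dualWeight d i k j) := by
  have h1 := hd.piecewiseFlat.length_pos hT
  have h2 := hd.piecewiseFlat.length_pos hT.swap_right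
  have h3 := hd.piecewiseFlat.doubleArea_pos hT
  have h4 := hd.piecewiseFlat.doubleArea_sq hT
  rw [hd.piecewiseFlat.dualWeight_eq hT, hd.piecewiseFlat.dualWeight_eq hT.swap_right,
    doubleArea_swap_right _ i j k, sideInner_swap _ i j k]
  field_simp
  rw [h4]
  ring

theorem IsMetric.pedalRatio_pos_of_pos_of_nonpos (hd : IsMetric S d) (hpos : HasPositiveWeights S d)
    (hT : S.IsTriangle i j k) (hu : dualWeight d i j k ≤ 0) : 0 < pedalRatio d i j k := by
  have hℓ := hd.piecewiseFlat
  have h : ∀ {i j k}, S.IsTriangle i j k → 0 < sideInner (edgeLength d) i j k * dualWeight d i j k +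
      edgeLength d s(i, k) ^ 2 * dualWeight d i k j := fun {i j k} hT => by
    have h1 := mul_pos (hpos i j hT.adj) (hℓ.doubleArea_pos hT)
    rw [hd.mul_doubleArea hT] at h1
    exact (mul_pos_iff_of_pos_left (hℓ.length_pos hT)).1 h1
  have hA : sideInner (edgeLength d) i j k + sideInner (edgeLength d) j i k =
      edgeLength d s(i, j) ^ 2 := by
    unfold sideInner
    rw [Sym2.eq_swap (a := j) (b := i)]
    ring
  have h1 := h hT
  have h2 := h hT.swap_right
  have h3 := h hT.swap_left
  have h4 := h hT.rotate
  have h5 := hℓ.sideInner_sq_lt hT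
  have h6 := hℓ.sideInner_sq_lt hT.swap_left
  have h7 := hℓ.length_pos hT
  rw [hd.dualWeight_swap hT] at h3 h4
  rw [sideInner_swap _ i j k] at h2
  rw [sideInner_swap _ j i k] at h4
  rw [Sym2.eq_swap (a := j) (b := i), ← hA] at h4
  rw [Sym2.eq_swap (a := j) (b := i), mul_pow, ← hA] at h6
  rw [mul_pow, ← hA] at h5
  rw [← hA] at h2
  exact symm_two_pos_of_nonpos hu (hA ▸ by positivity) h5 h6 h1 h2 h3 h4

theorem IsMetric.pedalRatio_pos_of_pos (hd : IsMetric S d) (hpos : HasPositiveWeights S d)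
    (hT : S.IsTriangle i j k) : 0 < pedalRatio d i j k := by
  rcases le_or_gt (dualWeight d i j k) 0 with hu | hu
  · exact hd.pedalRatio_pos_of_pos_of_nonpos hpos hT hu
  rcases le_or_gt (dualWeight d j k i) 0 with hv | hv
  · rw [← hd.pedalRatio_rotate hT]
    exact hd.pedalRatio_pos_of_pos_of_nonpos hpos hT.rotate hv
  rcases le_or_gt (dualWeight d i k j) 0 with hw | hw
  · rw [← hd.pedalRatio_rotate hT, ← hd.pedalRatio_rotate hT.rotate]
    rw [← hd.dualWeight_swap hT.swap_right] at hw
    exact hd.pedalRatio_pos_of_pos_of_nonpos hpos hT.rotate.rotate hw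
  unfold pedalRatio
  positivity

/-- The edge centers are midpoints, so the center is the circumcenter and its pedal triangle is the
medial triangle. -/
theorem IsMetric.pedalRatio_of_symm (hd : IsMetric S d)
    (hsymm : ∀ i j, S.skeleton.Adj i j → d i j = d j i) (hT : S.IsTriangle i j k) :
    pedalRatio d i j k = 1 / 4 := by
  have h1 := hd.piecewiseFlat.length_pos hT
  have h2 := hd.piecewiseFlat.length_pos hT.rotate
  have h3 := hd.piecewiseFlat.length_pos hT.swap_right
  have h4 := hd.piecewiseFlat.doubleArea_pos hT
  have h5 := hd.piecewiseFlat.doubleArea_sq hT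
  have hij := hsymm i j hT.adj
  have hjk := hsymm j k hT.rotate.adj
  have hik := hsymm i k hT.swap_right.adj
  unfold pedalRatio
  rw [hd.piecewiseFlat.dualWeight_eq hT, hd.piecewiseFlat.dualWeight_eq hT.rotate,
    hd.piecewiseFlat.dualWeight_eq hT.swap_right, doubleArea_swap_right _ i j k,
    doubleArea_swap_right _ j i k, doubleArea_swap_left _ i j k]
  generalize doubleArea (edgeLength d) i j k = Δ at *
  unfold sideInner at *
  rw [Sym2.eq_swap (a := j) (b := i), Sym2.eq_swap (a := k) (b := i),
    Sym2.eq_swap (a := k) (b := j)]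
  rw [show d j i = d i j from hij.symm]
  have e1 : d i j = edgeLength d s(i, j) / 2 := by rw [edgeLength_mk]; linarith
  have e2 : d j k = edgeLength d s(j, k) / 2 := by rw [edgeLength_mk]; linarith
  have e3 : d i k = edgeLength d s(i, k) / 2 := by rw [edgeLength_mk]; linarith
  rw [e1, e2, e3]
  field_simp
  rw [h5]
  ring

/-- `α` and `β` are the inner products of the center, seen from `v_i`, with the two sides there. The
area identity eliminates the weight of the third side. -/
theorem IsMetric.pedalRatio_mul (hd : IsMetric S d) (hT : S.IsTriangle i j k) {a b g α β : ℝ}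
    (ha : a = edgeLength d s(i, j)) (hb : b = edgeLength d s(i, k))
    (hg : g = sideInner (edgeLength d) i j k) (hα : α = a * d i j) (hβ : β = b * d i k) :
    pedalRatio d i j k * (a ^ 2 * b ^ 2 * edgeLength d s(j, k) ^ 2) =
      a ^ 2 * b ^ 2 * (α + β) - g * (α * b ^ 2 + β * a ^ 2) -
        (b ^ 2 * α ^ 2 + a ^ 2 * β ^ 2 - 2 * g * α * β) := by
  have h1 := (hd.piecewiseFlat.length_pos hT).ne'
  have h3 := (hd.piecewiseFlat.length_pos hT.swap_right).ne'
  have h4 := hd.piecewiseFlat.doubleArea_pos hT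
  have h5 := hd.piecewiseFlat.doubleArea_sq hT
  have h6 := hd.sum_length_sq_mul_dualWeight hT
  have hu := hd.piecewiseFlat.dualWeight_eq hT
  have hv := hd.piecewiseFlat.dualWeight_eq hT.swap_right
  rw [doubleArea_swap_right _ i j k, sideInner_swap _ i j k] at hv
  have hc : edgeLength d s(j, k) ^ 2 = a ^ 2 + b ^ 2 - 2 * g := by
    rw [hg, ha, hb]
    unfold sideInner
    ring
  unfold pedalRatio
  rw [← ha, ← hb, ← hg] at *
  generalize doubleArea (edgeLength d) i j k = Δ at *
  have hU : a ^ 2 * dualWeight d i j k * Δ = a ^ 2 * β - g * α := by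
    rw [hu, hβ, hα]
    field_simp
  have hW : b ^ 2 * dualWeight d i k j * Δ = b ^ 2 * α - g * β := by
    rw [hv, hβ, hα]
    field_simp
  rw [hc] at h6 ⊢
  generalize dualWeight d i j k = u at *
  generalize dualWeight d i k j = v at *
  generalize dualWeight d j k i = w at *
  have hW' : (a ^ 2 + b ^ 2 - 2 * g) * w = Δ - a ^ 2 * u - b ^ 2 * v := by linarith
  have hΔ : Δ ^ 2 ≠ 0 := by positivity
  refine mul_right_cancel₀ hΔ ?_
  calc _ = ((a ^ 2 + b ^ 2 - 2 * g) * (a ^ 2 * u * Δ) * (b ^ 2 * v * Δ) +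
        (b ^ 2 * (a ^ 2 * u * Δ) + a ^ 2 * (b ^ 2 * v * Δ)) *
          (((a ^ 2 + b ^ 2 - 2 * g) * w) * Δ)) := by ring
    _ = ((a ^ 2 + b ^ 2 - 2 * g) * (a ^ 2 * u * Δ) * (b ^ 2 * v * Δ) +
        (b ^ 2 * (a ^ 2 * u * Δ) + a ^ 2 * (b ^ 2 * v * Δ)) *
          (Δ ^ 2 - a ^ 2 * u * Δ - b ^ 2 * v * Δ)) := by rw [hW']; ring
    _ = _ := by rw [hU, hW, h5]; ring

/-- Euler's pedal triangle theorem: the signed area of the pedal triangle is proportional to `R² -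
|c - O|²`. -/
theorem IsMetric.pedalRatio_pos_of_dist_lt (hd : IsMetric S d) (hT : S.IsTriangle i j k)
    {s : Affine.Triangle ℝ (EuclideanSpace ℝ (Fin 2))} (hs : IsEmbedding (edgeLength d) i j k s)
    {c : EuclideanSpace ℝ (Fin 2)} (hc : IsCenter d i j k s c)
    (hdist : dist c s.circumcenter < s.circumradius) : 0 < pedalRatio d i j k := by
  have h1 := hd.piecewiseFlat.length_pos hT
  have h2 := hd.piecewiseFlat.length_pos hT.swap_right
  have h3 := hd.piecewiseFlat.length_pos hT.rotate
  have hlt := hd.piecewiseFlat.sideInner_sq_lt hT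
  have hR := fun a => s.dist_circumcenter_eq_circumradius a
  have hp : ‖s.points 1 - s.points 0‖ = edgeLength d s(i, j) := by
    rw [← dist_eq_norm, dist_comm, hs.1]
  have hq : ‖s.points 2 - s.points 0‖ = edgeLength d s(i, k) := by
    rw [← dist_eq_norm, hs.2.2, Sym2.eq_swap]
  have hpq := inner_sub_eq hs
  obtain ⟨hc1, -, hc3⟩ := hc
  rw [Sym2.eq_swap] at hc3
  have hR0 := hR 0
  have hR1 := hR 1
  have hR2 := hR 2
  obtain ⟨p, hp'⟩ : ∃ p, p = s.points 1 - s.points 0 := ⟨_, rfl⟩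
  obtain ⟨q, hq'⟩ : ∃ q, q = s.points 2 - s.points 0 := ⟨_, rfl⟩
  obtain ⟨y, hy'⟩ : ∃ y, y = c - s.points 0 := ⟨_, rfl⟩
  obtain ⟨o, ho'⟩ : ∃ o, o = s.circumcenter - s.points 0 := ⟨_, rfl⟩
  rw [← hp'] at hp hpq
  rw [← hq'] at hq hpq
  have hα : inner ℝ y p = edgeLength d s(i, j) * d i j := by
    rw [AffineMap.lineMap_apply, vsub_eq_sub, vadd_eq_add, ← hp',
      show c - (((d i j / edgeLength d s(i, j)) • p) + s.points 0) =
        y - (d i j / edgeLength d s(i, j)) • p by rw [hy']; abel,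
      inner_sub_left, real_inner_smul_left, real_inner_self_eq_norm_sq, hp, sub_eq_zero] at hc1
    rw [hc1]
    field_simp
  have hβ : inner ℝ y q = edgeLength d s(i, k) * d i k := by
    rw [AffineMap.lineMap_apply, vsub_eq_sub, vadd_eq_add,
      show s.points 0 - s.points 2 = -q by rw [hq']; abel,
      show c - (((d k i / edgeLength d s(i, k)) • (-q)) + s.points 2) =
        y - q + (d k i / edgeLength d s(i, k)) • q by rw [hy', hq', smul_neg]; abel,
      inner_neg_right, neg_eq_zero, inner_add_left, inner_sub_left, real_inner_smul_left,
      real_inner_self_eq_norm_sq, hq] at hc3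
    field_simp at hc3
    rw [edgeLength_mk] at hc3 ⊢
    linarith
  have ho : ‖o‖ = s.circumradius := by
    rw [ho', ← dist_eq_norm, dist_comm, hR0]
  have hop : inner ℝ o p = edgeLength d s(i, j) ^ 2 / 2 := by
    have := norm_sub_sq_real o p
    rw [hp, ho, show o - p = s.circumcenter - s.points 1 by rw [ho', hp']; abel, ← dist_eq_norm,
      dist_comm, hR1] at this
    linarith
  have hoq : inner ℝ o q = edgeLength d s(i, k) ^ 2 / 2 := by
    have := norm_sub_sq_real o q
    rw [hq, ho, show o - q = s.circumcenter - s.points 2 by rw [ho', hq']; abel, ← dist_eq_norm,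
      dist_comm, hR2] at this
    linarith
  -- As `‖o‖` is the circumradius, this quantity is `R² - |c - O|²`, minus the power of the center.
  -- Its product with the Gram determinant is the right side of `IsMetric.pedalRatio_mul`.
  have hyo : 0 < 2 * inner ℝ y o - inner ℝ y y := by
    have h4 := norm_sub_sq_real y o
    rw [real_inner_self_eq_norm_sq]
    rw [dist_eq_norm, show c - s.circumcenter = y - o by rw [hy', ho']; abel, ← ho] at hdist
    have := pow_lt_pow_left₀ hdist (norm_nonneg _) two_ne_zero
    linarith
  have e1 := gram_mul_inner p q y o
  have e2 := gram_mul_inner p q y y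
  rw [hp, hq, hpq, hα, hβ] at e1 e2
  rw [hop, hoq] at e1
  have hN := hd.pedalRatio_mul hT rfl rfl rfl rfl rfl
  have hpos := mul_pos (sub_pos.2 hlt) hyo
  refine pos_of_mul_pos_left (b := edgeLength d s(i, j) ^ 2 * edgeLength d s(i, k) ^ 2 *
    edgeLength d s(j, k) ^ 2) ?_ (by positivity)
  rw [hN]
  linarith

theorem IsMetric.hasDefiniteLaplacian (hd : IsMetric S d)
    (h : HasPositiveDualLengths S d ∨ IsNonnegInversiveDistance S d ∨ HasPositiveWeights S d ∨
      IsPerpendicularBisector S d ∨ HasCentersInCircumcircles S d) :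
    HasDefiniteLaplacian S d := by
  rcases h with h | h | h | h | h
  · exact Or.inl h
  · obtain ⟨η, f, h⟩ := h
    refine Or.inr fun i j k hT => hd.pedalRatio_pos_of_pos (fun i j hij => ?_) hT
    obtain ⟨hη, he⟩ := h i j hij
    rw [he]
    positivity
  · exact Or.inr fun i j k hT => hd.pedalRatio_pos_of_pos h hT
  · obtain ⟨L, f, -, h⟩ := h
    refine Or.inr fun i j k hT => ?_
    rw [hd.pedalRatio_of_symm (fun i j hij => ?_) hT]
    · norm_num
    · rw [h i j hij, h j i hij.symm, Sym2.eq_swap, add_comm]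
  · refine Or.inr fun i j k hT => ?_
    obtain ⟨s, hs⟩ := hd.piecewiseFlat i j k hT
    obtain ⟨c, hc, hdist⟩ := h i j k hT s hs
    exact hd.pedalRatio_pos_of_dist_lt hT hs hc hdist

variable {d' : V → V → ℝ}

/-! ### Scale invariance and openness of definiteness. -/

section Scaling

variable {c : ℝ}

theorem edgeLength_scale (h : ∀ i j, S.skeleton.Adj i j → d' i j = c * d i j)
    (hij : S.skeleton.Adj i j) : edgeLength d' s(i, j) = c * edgeLength d s(i, j) := by
  rw [edgeLength_mk, edgeLength_mk, h i j hij, h j i hij.symm]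
  ring

theorem height_scale (hc : 0 < c) (h : ∀ i j, S.skeleton.Adj i j → d' i j = c * d i j)
    (hT : S.IsTriangle i j k) : height d' i j k = c * height d i j k := by
  have hangle : angle (edgeLength d') i j k = angle (edgeLength d) i j k := by
    unfold angle
    rw [edgeLength_scale h hT.adj, edgeLength_scale h hT.swap_right.adj,
      edgeLength_scale h hT.rotate.adj]
    congr 1
    rw [← mul_div_mul_left _ (2 * edgeLength d s(i, j) * edgeLength d s(i, k))
      (pow_ne_zero 2 hc.ne')]
    ring_nf
  unfold height
  rw [hangle, h i j hT.adj, h i k hT.swap_right.adj]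
  ring

theorem dualWeight_scale (hc : 0 < c) (h : ∀ i j, S.skeleton.Adj i j → d' i j = c * d i j)
    (hT : S.IsTriangle i j k) : dualWeight d' i j k = dualWeight d i j k := by
  unfold dualWeight
  rw [height_scale hc h hT, edgeLength_scale h hT.adj, mul_div_mul_left _ _ hc.ne']

theorem HasDefiniteLaplacian.scale (hL : HasDefiniteLaplacian S d) (hc : 0 < c)
    (h : ∀ i j, S.skeleton.Adj i j → d' i j = c * d i j) : HasDefiniteLaplacian S d' := by
  refine hL.imp (fun hL i j hij => ?_) fun hL i j k hT => ?_
  · have : dualLength S d' i j = c * dualLength S d i j := by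
      unfold dualLength
      rw [Finset.mul_sum]
      refine Finset.sum_congr rfl fun k _ => ?_
      split_ifs with hT
      · exact height_scale hc h hT
      · simp
    rw [this]
    exact mul_pos hc (hL i j hij)
  · unfold pedalRatio
    rw [dualWeight_scale hc h hT, dualWeight_scale hc h hT.rotate,
      dualWeight_scale hc h hT.swap_right]
    exact hL i j k hT

end Scaling

section Continuity

variable {D : ℝ → V → V → ℝ} {t : ℝ}

theorem continuousAt_edgeLength
    (hD : ∀ i j, S.skeleton.Adj i j → ContinuousAt (fun τ => D τ i j) t)
    (hij : S.skeleton.Adj i j) : ContinuousAt (fun τ => edgeLength (D τ) s(i, j)) t :=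
  (hD i j hij).add (hD j i hij.symm)

theorem continuousAt_height (hd : IsMetric S (D t))
    (hD : ∀ i j, S.skeleton.Adj i j → ContinuousAt (fun τ => D τ i j) t)
    (hT : S.IsTriangle i j k) : ContinuousAt (fun τ => height (D τ) i j k) t := by
  have h1 := hd.piecewiseFlat.length_pos hT
  have h2 := hd.piecewiseFlat.length_pos hT.swap_right
  have c1 := continuousAt_edgeLength hD hT.adj
  have c2 := continuousAt_edgeLength hD hT.swap_right.adj
  have c3 := continuousAt_edgeLength hD hT.rotate.adj
  have hangle : ContinuousAt (fun τ => angle (edgeLength (D τ)) i j k) t := by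
    unfold angle
    exact Real.continuous_arccos.continuousAt.comp
      ((((c1.pow 2).add (c2.pow 2)).sub (c3.pow 2)).div ((c1.const_mul 2).mul c2) (by positivity))
  have hsin : Real.sin (angle (edgeLength (D t)) i j k) ≠ 0 := by
    rw [hd.piecewiseFlat.sin_angle hT]
    exact (div_pos (hd.piecewiseFlat.doubleArea_pos hT) (mul_pos h1 h2)).ne'
  exact ((hD i k hT.swap_right.adj).sub
    ((hD i j hT.adj).mul (Real.continuous_cos.continuousAt.comp hangle))).div
    (Real.continuous_sin.continuousAt.comp hangle) hsin

theorem continuousAt_dualWeight (hd : IsMetric S (D t))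
    (hD : ∀ i j, S.skeleton.Adj i j → ContinuousAt (fun τ => D τ i j) t)
    (hT : S.IsTriangle i j k) : ContinuousAt (fun τ => dualWeight (D τ) i j k) t :=
  (continuousAt_height hd hD hT).div (continuousAt_edgeLength hD hT.adj)
    (hd.piecewiseFlat.length_pos hT).ne'

theorem HasDefiniteLaplacian.eventually (hL : HasDefiniteLaplacian S (D t)) (hd : IsMetric S (D t))
    (hD : ∀ i j, S.skeleton.Adj i j → ContinuousAt (fun τ => D τ i j) t) :
    ∀ᶠ τ in nhds t, HasDefiniteLaplacian S (D τ) := by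
  rcases hL with hL | hL
  · have h : ∀ᶠ τ in nhds t, HasPositiveDualLengths S (D τ) := by
      unfold HasPositiveDualLengths
      simp only [Filter.eventually_all]
      intro i j hij
      have hc : ContinuousAt (fun τ => dualLength S (D τ) i j) t := by
        refine tendsto_finsetSum _ fun k _ => ?_
        split_ifs with hT
        · exact continuousAt_height hd hD hT
        · exact tendsto_const_nhds
      exact hc.eventually (lt_mem_nhds (hL i j hij))
    exact h.mono fun τ => Or.inl
  · have h : ∀ᶠ τ in nhds t, ∀ i j k, S.IsTriangle i j k → 0 < pedalRatio (D τ) i j k := by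
      simp only [Filter.eventually_all]
      intro i j k hT
      have c1 := continuousAt_dualWeight hd hD hT
      have c2 := continuousAt_dualWeight hd hD hT.rotate
      have c3 := continuousAt_dualWeight hd hD hT.swap_right
      have hc : ContinuousAt (fun τ => pedalRatio (D τ) i j k) t :=
        ((c1.mul c2).add (c2.mul c3)).add (c3.mul c1)
      exact hc.eventually (lt_mem_nhds (hL i j k hT))
    exact h.mono fun τ => Or.inr

end Continuity

/-! ### First-order identities of a conformal structure. -/

section ConformalStructure

variable {U : Set (V → ℝ)} {C : (V → ℝ) → V → V → ℝ} {f : V → ℝ}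

theorem IsConformalStructure.contDiffAt (hC : IsConformalStructure S U C) (hf : f ∈ U)
    (hij : S.skeleton.Adj i j) : ContDiffAt ℝ ∞ (fun g => C g i j) f :=
  (hC.smooth i j hij).contDiffAt (hC.isOpen.mem_nhds hf)

theorem IsConformalStructure.differentiableAt (hC : IsConformalStructure S U C) (hf : f ∈ U)
    (hij : S.skeleton.Adj i j) : DifferentiableAt ℝ (fun g => C g i j) f :=
  (hC.contDiffAt hf hij).differentiableAt (by simp)

theorem IsConformalStructure.fderiv_length (hC : IsConformalStructure S U C) (hf : f ∈ U)
    (hij : S.skeleton.Adj i j) :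
    fderiv ℝ (fun g => edgeLength (C g) s(i, j)) f (Pi.single i 1) = C f i j := by
  have h : DifferentiableAt ℝ (fun g => edgeLength (C g) s(i, j)) f :=
    (hC.differentiableAt hf hij).add (hC.differentiableAt hf hij.symm)
  exact (h.hasFDerivAt.hasLineDerivAt _).unique (hC.length_deriv f hf i j hij)

theorem IsConformalStructure.fderiv_eq_zero (hC : IsConformalStructure S U C) (hf : f ∈ U)
    (hij : S.skeleton.Adj i j) (hi : k ≠ i) (hj : k ≠ j) :
    fderiv ℝ (fun g => C g i j) f (Pi.single k 1) = 0 :=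
  ((hC.differentiableAt hf hij).hasFDerivAt.hasLineDerivAt _).unique
    (hC.deriv_eq_zero f hf i j k hij hi hj)

theorem IsConformalStructure.fderiv_apply (hC : IsConformalStructure S U C) (hf : f ∈ U)
    (hij : S.skeleton.Adj i j) (x : V → ℝ) :
    fderiv ℝ (fun g => C g i j) f x = fderiv ℝ (fun g => C g i j) f (Pi.single i 1) * x i +
      fderiv ℝ (fun g => C g i j) f (Pi.single j 1) * x j := by
  conv_lhs => rw [← Finset.univ_sum_single x, map_sum]
  have h : ∀ k, fderiv ℝ (fun g => C g i j) f (Pi.single k (x k)) =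
      fderiv ℝ (fun g => C g i j) f (Pi.single k 1) * x k := fun k => by
    rw [show (Pi.single k (x k) : V → ℝ) = x k • Pi.single k 1 by
      rw [← Pi.single_smul, smul_eq_mul, mul_one], map_smul, smul_eq_mul, mul_comm]
  rw [Finset.sum_eq_add i j hij.1 _ (by simp) (by simp), h, h]
  intro k _ hk
  rw [h, hC.fderiv_eq_zero hf hij hk.1 hk.2, zero_mul]

/-- Both sides are mixed second derivatives of `ℓ_ij`, because `d_ij` and `d_ji` are its first
derivatives near `f`. -/
theorem IsConformalStructure.fderiv_symm (hC : IsConformalStructure S U C) (hf : f ∈ U)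
    (hij : S.skeleton.Adj i j) : fderiv ℝ (fun g => C g i j) f (Pi.single j 1) =
      fderiv ℝ (fun g => C g j i) f (Pi.single i 1) := by
  set F : (V → ℝ) → ℝ := fun g => edgeLength (C g) s(i, j) with hF
  have hFC : ContDiffAt ℝ ∞ F f := (hC.contDiffAt hf hij).add (hC.contDiffAt hf hij.symm)
  have hsymm : IsSymmSndFDerivAt ℝ F f :=
    hFC.isSymmSndFDerivAt (by
      simp only [minSmoothness_of_isRCLikeNormedField]
      exact WithTop.coe_le_coe.2 (le_top (a := (2 : ℕ∞))))
  have hdiff : DifferentiableAt ℝ (fderiv ℝ F) f :=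
    (hFC.fderiv_right (m := 1)
      (WithTop.coe_le_coe.2 (le_top (a := (1 + 1 : ℕ∞))))).differentiableAt one_ne_zero
  have hU := hC.isOpen.mem_nhds hf
  have hi : (fun g => C g i j) =ᶠ[nhds f] fun g => fderiv ℝ F g (Pi.single i 1) :=
    Filter.mem_of_superset hU fun g hg => (hC.fderiv_length hg hij).symm
  have hj : (fun g => C g j i) =ᶠ[nhds f] fun g => fderiv ℝ F g (Pi.single j 1) :=
    Filter.mem_of_superset hU fun g hg => by
      have := hC.fderiv_length hg hij.symm
      simp only [Sym2.eq_swap (a := j) (b := i)] at this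
      exact this.symm
  have key : ∀ v w : V → ℝ, fderiv ℝ (fun g => fderiv ℝ F g w) f v =
      fderiv ℝ (fderiv ℝ F) f v w := fun v w => by
    rw [(hdiff.hasFDerivAt.clm_apply (hasFDerivAt_const w f)).fderiv]
    simp
  rw [hi.fderiv_eq, hj.fderiv_eq, key, key]
  exact hsymm _ _

/-- By `fderiv_symm` the sum is `∂(d_ij + d_ji)/∂f_i = ∂ℓ_ij/∂f_i`. This is Euler's identity for
scaling under constant shifts of `f`. -/
theorem IsConformalStructure.fderiv_single_add (hC : IsConformalStructure S U C) (hf : f ∈ U)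
    (hij : S.skeleton.Adj i j) : fderiv ℝ (fun g => C g i j) f (Pi.single i 1) +
      fderiv ℝ (fun g => C g i j) f (Pi.single j 1) = C f i j := by
  rw [hC.fderiv_symm hf hij, ← hC.fderiv_length hf hij]
  simp only [edgeLength_mk]
  rw [fderiv_fun_add (hC.differentiableAt hf hij) (hC.differentiableAt hf hij.symm)]
  rfl

theorem IsConformalStructure.hasDerivAt_length (hC : IsConformalStructure S U C)
    {f : ℝ → V → ℝ} {t : ℝ} {x : V → ℝ} (hf : HasDerivAt f x t) (hU : f t ∈ U)
    (hij : S.skeleton.Adj i j) :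
    HasDerivAt (fun τ => edgeLength (C (f τ)) s(i, j)) (C (f t) i j * x i + C (f t) j i * x j)
      t := by
  have h1 := (hC.differentiableAt hU hij).hasFDerivAt.comp_hasDerivAt t hf
  have h2 := (hC.differentiableAt hU hij.symm).hasFDerivAt.comp_hasDerivAt t hf
  refine (h1.add h2).congr_deriv ?_
  rw [hC.fderiv_apply hU hij, hC.fderiv_apply hU hij.symm]
  linear_combination x i * hC.fderiv_single_add hU hij + x j * hC.fderiv_single_add hU hij.symm +
    (x j - x i) * hC.fderiv_symm hU hij

theorem IsConformalStructure.hasDerivAt_of_const (hC : IsConformalStructure S U C)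
    {f : ℝ → V → ℝ} {t : ℝ} {x : V → ℝ} (hf : HasDerivAt f x t) (hU : f t ∈ U)
    (hij : S.skeleton.Adj i j) (hx : x i = x j) :
    HasDerivAt (fun τ => C (f τ) i j) (x i * C (f t) i j) t := by
  refine ((hC.differentiableAt hU hij).hasFDerivAt.comp_hasDerivAt t hf).congr_deriv ?_
  rw [hC.fderiv_apply hU hij, ← hx, ← add_mul, hC.fderiv_single_add hU hij, mul_comm]

end ConformalStructure

/-! ### Variation of curvature and rigidity. -/

theorem hasDerivAt_curvature {D : ℝ → V → V → ℝ} {t : ℝ} {x : V → ℝ} (hd : IsMetric S (D t))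
    (hD : ∀ i j, S.skeleton.Adj i j →
      HasDerivAt (fun τ => edgeLength (D τ) s(i, j)) (D t i j * x i + D t j i * x j) t) (i : V) :
    HasDerivAt (fun τ => curvature S (edgeLength (D τ)) i)
      (-(1 / 2 * ∑ j, ∑ k, if S.IsTriangle i j k then
        dualWeight (D t) i j k * (x j - x i) + dualWeight (D t) i k j * (x k - x i) else 0)) t := by
  unfold curvature
  refine HasDerivAt.const_sub _ (HasDerivAt.const_mul _
    (HasDerivAt.fun_sum fun j _ => HasDerivAt.fun_sum fun k _ => ?_))
  split_ifs with hT
  · exact hasDerivAt_angle hd hD hT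
  · exact hasDerivAt_const t 0

variable {U : Set (V → ℝ)} {C : (V → ℝ) → V → V → ℝ} {f : ℝ → V → ℝ} {ε t : ℝ}

theorem IsConformalVariation.hasDerivAt (hf : IsConformalVariation S d U C ε f)
    (ht : t ∈ Set.Ioo (-ε) ε) : HasDerivAt f (deriv f t) t :=
  ((hf.smooth.contDiffAt (isOpen_Ioo.mem_nhds ht)).differentiableAt (by simp)).hasDerivAt

theorem IsConformalVariation.continuousAt (hf : IsConformalVariation S d U C ε f)
    (ht : t ∈ Set.Ioo (-ε) ε) (hij : S.skeleton.Adj i j) :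
    ContinuousAt (fun τ => C (f τ) i j) t :=
  (hf.conformal.differentiableAt (hf.mapsTo ht) hij).continuousAt.comp
    (f := f) (hf.hasDerivAt ht).continuousAt

theorem IsConformalVariation.hasDerivAt_of_curvature_eq (hS : S.skeleton.Connected)
    (hf : IsConformalVariation S d U C ε f)
    (hcurv : ∀ t ∈ Set.Ioo (-ε) ε, ∀ i,
      curvature S (edgeLength (C (f t))) i = curvature S (edgeLength d) i)
    (ht : t ∈ Set.Ioo (-ε) ε) (hL : HasDefiniteLaplacian S (C (f t))) :
    ∃ r : ℝ, ∀ i j, S.skeleton.Adj i j →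
      HasDerivAt (fun τ => C (f τ) i j) (r * C (f t) i j) t := by
  have hU := hf.mapsTo ht
  have hd := hf.conformal.isMetric _ hU
  have hx := hf.hasDerivAt ht
  have hconst := hd.eq_of_stationary hS hL (x := deriv f t) fun i => by
    have h1 := hasDerivAt_curvature (D := fun τ => C (f τ)) hd
      (fun i j hij => hf.conformal.hasDerivAt_length hx hU hij) i
    have h2 : (fun τ => curvature S (edgeLength (C (f τ))) i) =ᶠ[nhds t]
        fun _ => curvature S (edgeLength d) i :=
      Filter.mem_of_superset (isOpen_Ioo.mem_nhds ht) fun τ hτ => hcurv τ hτ i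
    have h3 := h1.unique ((hasDerivAt_const t _).congr_of_eventuallyEq h2)
    linarith
  obtain ⟨v⟩ := hS.nonempty
  refine ⟨deriv f t v, fun i j hij => ?_⟩
  rw [hconst v i]
  exact hf.conformal.hasDerivAt_of_const hx hU hij (hconst i j)

theorem IsConformalVariation.eq_scale (hS : S.skeleton.Connected)
    (hf : IsConformalVariation S d U C ε f)
    (hcurv : ∀ t ∈ Set.Ioo (-ε) ε, ∀ i,
      curvature S (edgeLength (C (f t))) i = curvature S (edgeLength d) i)
    (hL : HasDefiniteLaplacian S d) (ht : t ∈ Set.Ioo (-ε) ε) :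
    ∃ c : ℝ, 0 < c ∧ ∀ i j, S.skeleton.Adj i j → C (f t) i j = c * d i j := by
  by_cases hne : ∃ a b, S.skeleton.Adj a b
  swap
  · exact ⟨1, one_pos, fun i j hij => (hne ⟨i, j, hij⟩).elim⟩
  obtain ⟨a, b, hab⟩ := hne
  have hpos : ∀ t ∈ Set.Ioo (-ε) ε, 0 < edgeLength (C (f t)) s(a, b) := fun t ht =>
    (hf.conformal.isMetric _ (hf.mapsTo ht)).piecewiseFlat.length_pos
      (TriangulatedSurface.exists_isTriangle hab).choose_spec
  have h0 : (0 : ℝ) ∈ Set.Ioo (-ε) ε := ⟨neg_lt_zero.2 hf.pos, hf.pos⟩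
  -- Dividing by one reference length removes the unknown rate of scaling, so that rate never has to
  -- be integrated or shown to depend regularly on time.
  set r : V → V → ℝ → ℝ := fun i j τ => C (f τ) i j / edgeLength (C (f τ)) s(a, b) with hr
  have hrc : ∀ t ∈ Set.Ioo (-ε) ε, ∀ {i j}, S.skeleton.Adj i j → ContinuousAt (r i j) t :=
    fun t ht i j hij => (hf.continuousAt ht hij).div
      (continuousAt_edgeLength (fun i j => hf.continuousAt ht) hab) (hpos t ht).ne'
  set A : Set ℝ := {t | t ∈ Set.Ioo (-ε) ε ∧ ∀ i j, S.skeleton.Adj i j → r i j t = r i j 0} with hA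
  have hscale : ∀ t ∈ A, ∃ c : ℝ, 0 < c ∧ ∀ i j, S.skeleton.Adj i j →
      C (f t) i j = c * d i j := fun t ⟨ht, h⟩ => by
    refine ⟨edgeLength (C (f t)) s(a, b) / edgeLength (C (f 0)) s(a, b),
      div_pos (hpos t ht) (hpos 0 h0), fun i j hij => ?_⟩
    have h1 := h i j hij
    simp only [hr] at h1
    rw [div_eq_iff (hpos t ht).ne', hf.init i j hij] at h1
    rw [h1]
    ring
  have hAo : IsOpen A := by
    refine isOpen_iff_mem_nhds.2 fun t htA => ?_
    obtain ⟨c, hc, hcd⟩ := hscale t htA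
    have ht := htA.1
    have hev := ((hL.scale hc hcd).eventually (D := fun τ => C (f τ))
      (hf.conformal.isMetric _ (hf.mapsTo ht)) fun i j => hf.continuousAt ht).and
      (isOpen_Ioo.mem_nhds ht)
    obtain ⟨δ, hδ, hball⟩ := Metric.eventually_nhds_iff_ball.1 hev
    refine Filter.mem_of_superset (Metric.ball_mem_nhds t hδ) fun τ hτ => ⟨(hball τ hτ).2, ?_⟩
    intro i j hij
    rw [← htA.2 i j hij]
    -- Numerator and denominator grow at the same rate `q`, so the quotient is stationary.
    have hder : ∀ τ ∈ Metric.ball t δ, HasDerivAt (r i j) 0 τ := fun τ hτ => by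
      obtain ⟨q, hq⟩ := hf.hasDerivAt_of_curvature_eq hS hcurv (hball τ hτ).2 (hball τ hτ).1
      refine ((hq i j hij).div ((hq a b hab).add (hq b a hab.symm))
        (hpos τ (hball τ hτ).2).ne').congr_deriv ?_
      simp only [Pi.add_apply]
      ring
    exact Metric.isOpen_ball.is_const_of_deriv_eq_zero (convex_ball t δ).isPreconnected
      (fun τ hτ => (hder τ hτ).differentiableAt.differentiableWithinAt)
      (fun τ hτ => (hder τ hτ).deriv) hτ (Metric.mem_ball_self hδ)
  have hsub : Set.Ioo (-ε) ε ⊆ A := by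
    -- `A` contains `0` and is relatively closed because every `r i j` is continuous, so it fills
    -- the interval.
    refine isPreconnected_Ioo.subset_of_closure_inter_subset hAo ⟨0, h0, h0, fun _ _ _ => rfl⟩ ?_
    rintro t ⟨htc, ht⟩
    refine ⟨ht, fun i j hij => ?_⟩
    obtain ⟨u, huA, hu⟩ := mem_closure_iff_seq_limit.1 htc
    refine tendsto_nhds_unique ((hrc t ht hij).tendsto.comp hu) ?_
    exact tendsto_const_nhds.congr fun n => ((huA n).2 i j hij).symm
  exact hscale t (hsub ht)

end PiecewiseFlat

end

theorem mainTheorem10 {V : Type*} [Fintype V] [DecidableEq V] (S : TriangulatedSurface V)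
    (hS : S.skeleton.Connected) (d : V → V → ℝ) (hd : PiecewiseFlat.IsMetric S d)
    (hK : ∀ i, PiecewiseFlat.curvature S (PiecewiseFlat.edgeLength d) i = 0)
    (h : PiecewiseFlat.HasPositiveDualLengths S d ∨
      PiecewiseFlat.IsNonnegInversiveDistance S d ∨
      PiecewiseFlat.HasPositiveWeights S d ∨
      PiecewiseFlat.IsPerpendicularBisector S d ∨
      PiecewiseFlat.HasCentersInCircumcircles S d) :
    PiecewiseFlat.IsConformallyRigid S d := by
  intro U C ε f hf hcurv t ht
  obtain ⟨c, hc, hcd⟩ := hf.eq_scale hS hcurv (hd.hasDefiniteLaplacian h) ht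
  exact ⟨c, hc, fun i j hij => PiecewiseFlat.edgeLength_scale hcd hij⟩
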